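/- **Lemma 3.4.** Let $j_\lambda,j_\mu,j_{\bar\mu}\in\{0,1,2\}$ and $j_c\ge 0$ be integers with $j_\mu+j_{\bar\mu}+j_\lambda+j_c=7$ (so $j_c+j_\lambda\ge 3$). Let $e\ge1$, and let $S,n,m_1,\dots,m_e$ be elements of a field $K$ with all $m_i\ne0$ (for example, independent variables, or the integers $n$, $m=m_1$ and the successive nonzero remainders of the Euclidean algorithm on $(m,n)$). Put $m=m_1$, $m_0=n$, $m_{e+1}=0$, and let $\ell_i=(m_{i-1}-m_{i+1})/m_i$, so that $$n=m_1\ell_1+m_2,\quad m_1=m_2\ell_2+m_3,\quad\dots,\quad m_{e-1}=m_e\ell_e .$$ The total local correction term from the $e$ directed blow-ups over the cusp $\lambda\cap\mu$ of curves $x^n=\alpha y^mz^{n-m}$ is $P_e=Q_1+\dots+Q_e$, where $Q_i$, the contribution of the $i$-th directed blow-up, is as follows. All Chow rings have coefficients in $K$, and $\int$ denotes the degree of the zero-dimensional part. * Let $k$ be the hyperplane class on $\mathbb P^2$. Then $$Q_1=\ell_1^{3-j_\lambda}\int_{\mathbb P^2}\frac{k(1+k)^{j_\mu}(1+\ell_1k)^{j_\lambda}k^{j_{\bar\mu}}(Sm_1+Snk)^{j_c}}{(1+\ell_1k)^3(1+k)^3}.$$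 * Let $B_1=\mathbb P(N)\to\mathbb P^2$ be the bundle of lines in a bundle $N$ of rank $3$ with $c(N)=(1+k)^3$, and let $e_1=c_1(\mathcal O(-1))$; thus $A(B_1)=A(\mathbb P^2)[e_1]/((k-e_1)^3)$, and the push-forward to $\mathbb P^2$ sends $1,e_1,e_1^2$ to $0,0,1$. Then $$Q_2=\ell_2^{3-j_\mu}\int_{B_1}\frac{k(1+\ell_2k-\ell_1\ell_2e_1)^{j_\mu}(k-e_1)^{j_\lambda}k^{j_{\bar\mu}}(Sm_2+Snk-S\ell_1m_1e_1)^{j_c}}{(1+\ell_2k-\ell_1\ell_2e_1)^3(1+e_1)}.$$ * Let $B_2\to B_1$ be the bundle of lines in a bundle of rank $3$ with total Chern class $(1+k-\ell_1e_1)^3$, and let $e_2=c_1(\mathcal O(-1))$; thus $A(B_2)=A(B_1)[e_2]/((k-\ell_1e_1-e_2)^3)$, and the push-forward to $B_1$ sends $1,e_2,e_2^2$ to $0,0,1$. The later centers $B_3,B_4,\dots$ are isomorphic to $B_2$. Put $e_i=e_{i-2}-\ell_{i-1}e_{i-1}$ for $i\ge3$. Then for $i\ge3$ $$Q_i=\ell_i\int_{B_2}\frac{k\,(k-\ell_1e_1-e_2)^{j_\mu}(k-e_1)^{j_\lambda}k^{j_{\bar\mu}}\Bigl(S\bigl(m_i+nk-\sum_{j=1}^{i-1}\ell_jm_je_j\bigr)\Bigr)^{j_c}}{(1+\ell_ie_{i-2}-\ell_{i-1}\ell_ie_{i-1})(1+e_{i-1})}.$$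 Then $$P_e=S^{j_c}\,n^{3-j_\lambda}\int_{\mathbb P^2}\frac{k^{j_{\bar\mu}+1}(m+nk)^{j_c+j_\lambda-3}}{(1+k)^{3-j_\mu}}.$$ In particular, $P_e$ depends only on $S$, $n$, $m$ and the exponents $j$: it is independent of $m_2,\dots,m_e$ and of the number of steps $e$. -/

import Mathlib

open Polynomial

namespace DirectedBlowups

noncomputable section

/-! ## Intersection rings of the centers

All Chow rings are taken with coefficients in a commutative ring `R`, in which the numbers
`S`, `n`, `mᵢ`, `ℓᵢ` (possibly indeterminates) live. -/

/-- The Chow ring of the projective bundle `ℙ(N)` of lines in a vector bundle `N` of rank `3` with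
total Chern class `c(N) = (1 + x) ^ 3`, over a base with Chow ring `A`.  It is generated over `A`
by the class `ε = c₁(𝒪(-1))`, subject to `c₃(N ⊗ 𝒪(1)) = (x - ε) ^ 3 = 0`. -/
abbrev ProjChow {A : Type*} [CommRing A] (x : A) : Type _ :=
  AdjoinRoot ((X - C x) ^ 3 : A[X])

/-- The push-forward `A(ℙ(N)) → A` for `N` as in `ProjChow`: the `A`-linear map with
`1 ↦ 0`, `ε ↦ 0`, `ε ^ 2 ↦ 1`. -/
def push {A : Type*} [CommRing A] (x : A) : ProjChow x →ₗ[A] A :=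
  (lcoeff A 2).comp (AdjoinRoot.modByMonicHom ((monic_X_sub_C x).pow 3))

section Rings

variable (R : Type*) [CommRing R]

/-- The Chow ring `R[k] / (k ^ 3)` of `B = ℙ²`. -/
abbrev ChowP2 : Type _ := ProjChow (0 : R)

/-- The hyperplane class of `ℙ²`. -/
def hyp : ChowP2 R := AdjoinRoot.root _

/-- The degree `∫` over `ℙ²`: the coefficient of `k ^ 2`. -/
def intP2 : ChowP2 R →ₗ[R] R := push (0 : R)

/-- The Chow ring of the fourfold `B₁ = ℙ(N)`, where `N` is the normal bundle of `ℙ²` in `ℙ⁵`,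
and `c(N) = (1 + k) ^ 3`. -/
abbrev ChowB1 : Type _ := ProjChow (hyp R)

/-- The (pull-back of the) class `k` on `B₁`. -/
def k1 : ChowB1 R := algebraMap (ChowP2 R) (ChowB1 R) (hyp R)

/-- The class `e₁ = c₁(𝒪(-1))` on `B₁`, the restriction of the exceptional divisor `E₁`. -/
def e1 : ChowB1 R := AdjoinRoot.root _

/-- The degree `∫` over `B₁`. -/
def intB1 : ChowB1 R →ₗ[R] R := (intP2 R).comp ((push (hyp R)).restrictScalars R)

variable {R}

/-- The class `k - ℓ₁ e₁` on `B₁`; the normal bundle of `B₁` in `E₁` has total Chern class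
`(1 + k - ℓ₁ e₁) ^ 3`. -/
def rootB1 (l1 : R) : ChowB1 R := k1 R - l1 • e1 R

/-- The Chow ring of the sixfold `B₂ = ℙ(N)`, where `N` is the normal bundle of `B₁` in `E₁`.
All later centers `B₃, B₄, …` are isomorphic to `B₂` (they are projectivizations of
line bundles). -/
abbrev ChowB2 (l1 : R) : Type _ := ProjChow (rootB1 l1)

/-- The (pull-back of the) class `k` on `B₂`. -/
def k2 (l1 : R) : ChowB2 l1 := algebraMap (ChowB1 R) (ChowB2 l1) (k1 R)

/-- The degree `∫` over `B₂`. -/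
def intB2 (l1 : R) : ChowB2 l1 →ₗ[R] R :=
  (intB1 R).comp ((push (rootB1 l1)).restrictScalars R)

/-- The classes `e₁, e₂, e₃, …` of the exceptional divisors, restricted to `B₂ ≅ B₃ ≅ …`:
`e₁` is pulled back from `B₁`, `e₂ = c₁(𝒪(-1))`, and `eᵢ = eᵢ₋₂ - ℓᵢ₋₁ eᵢ₋₁` for `i ≥ 3`.
The value at the index `0` is not used. -/
def exc (l : ℕ → R) : ℕ → ChowB2 (l 1)
  | 0 => 0
  | 1 => algebraMap (ChowB1 R) (ChowB2 (l 1)) (e1 R)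
  | 2 => AdjoinRoot.root _
  | (i + 3) => exc l (i + 1) - l (i + 2) • exc l (i + 2)

end Rings

/-! ## The correction terms

`jlam, jmu, jmub, jc` are the exponents `j_λ, j_μ, j_μ̄, j_c`.  The sequences `m`, `l` are
indexed so that `m i = mᵢ` and `l i = ℓᵢ` for `i ≥ 1`.  Denominators are total Chern classes,
of the form `1 + nilpotent`, hence units, and `Ring.inverse` is their inverse. -/

section Terms

variable {R : Type*} [CommRing R] (jlam jmu jmub jc : ℕ) (S n : R) (m l : ℕ → R)

/-- The contribution of the first directed blow-up (of `ℙ⁸` along `ℙ²` in the direction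
of `ℙ⁵`). -/
def Q1 : R :=
  l 1 ^ (3 - jlam) * intP2 R
    (hyp R * (1 + hyp R) ^ jmu * (1 + l 1 • hyp R) ^ jlam * hyp R ^ jmub *
      (algebraMap R _ (S * m 1) + (S * n) • hyp R) ^ jc *
      Ring.inverse ((1 + l 1 • hyp R) ^ 3 * (1 + hyp R) ^ 3))

/-- The contribution of the second directed blow-up (of `V₁` along `B₁` in the direction
of `E₁`). -/
def Q2 : R :=
  l 2 ^ (3 - jmu) * intB1 R
    (k1 R * (1 + l 2 • k1 R - (l 1 * l 2) • e1 R) ^ jmu * (k1 R - e1 R) ^ jlam * k1 R ^ jmub *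
      (algebraMap R _ (S * m 2) + (S * n) • k1 R - (S * l 1 * m 1) • e1 R) ^ jc *
      Ring.inverse ((1 + l 2 • k1 R - (l 1 * l 2) • e1 R) ^ 3 * (1 + e1 R)))

/-- The contribution of the `i`-th directed blow-up (of `Vᵢ₋₁` along `Bᵢ₋₁` in the direction
of `Eᵢ₋₁`), for `i ≥ 3`. -/
def Qge3 (i : ℕ) : R :=
  l i * intB2 (l 1)
    (k2 (l 1) * (k2 (l 1) - l 1 • exc l 1 - exc l 2) ^ jmu * (k2 (l 1) - exc l 1) ^ jlam *
      k2 (l 1) ^ jmub *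
      (S • (algebraMap R _ (m i) + n • k2 (l 1)
        - ∑ j ∈ Finset.Icc 1 (i - 1), (l j * m j) • exc l j)) ^ jc *
      Ring.inverse ((1 + l i • exc l (i - 2) - (l (i - 1) * l i) • exc l (i - 1)) *
        (1 + exc l (i - 1))))

/-- The contribution `Qᵢ` of the `i`-th directed blow-up, `i ≥ 1`
(the value at `0` is not used). -/
def Q : ℕ → R
  | 0 => 0
  | 1 => Q1 jlam jmu jmub jc S n m l
  | 2 => Q2 jlam jmu jmub jc S n m l
  | (i + 3) => Qge3 jlam jmu jmub jc S n m l (i + 3)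

/-- The total correction term `P_r(n, m₁, ℓ₁, …, m_r, ℓ_r) = Q₁ + ⋯ + Q_r` of the first `r`
directed blow-ups. -/
def P (r : ℕ) : R := ∑ i ∈ Finset.Icc 1 r, Q jlam jmu jmub jc S n m l i

end Terms

/-- `m₁, …, m_e`, `ℓ₁, …, ℓ_e` satisfy the `e` lines of the Euclidean algorithm
`n = m₁ ℓ₁ + m₂`, `m₁ = m₂ ℓ₂ + m₃`, …, `m_{e-1} = m_e ℓ_e` on `(m₁, n)`, with all `mᵢ` nonzero;
here `m 0 = n` and `m (e + 1) = 0`.  So `ℓᵢ = (mᵢ₋₁ - mᵢ₊₁) / mᵢ`, and `n, m₁, …, m_e`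
may be independent variables, or the numbers from the usual algorithm. -/
structure IsEuclidean {K : Type*} [Field K] (n m₁ : K) (e : ℕ) (m l : ℕ → K) : Prop where
  one_le : 1 ≤ e
  zero : m 0 = n
  one : m 1 = m₁
  last : m (e + 1) = 0
  ne_zero : ∀ i, 1 ≤ i → i ≤ e → m i ≠ 0
  step : ∀ i, i < e → m i = m (i + 1) * l (i + 1) + m (i + 2)

end

end DirectedBlowups

/-! Put a = k, b = k - e₁, d = k - ℓ₁e₁ - e₂. The Chow ring of `B₂` is K[a,b,d]/(a³,b³,d³), and its
degree map reads off the coefficient of a²b²d². With e₀ = ℓ₁e₁ + e₂ and L_i = nk - ∑_{j≤i} ℓⱼmⱼeⱼ,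
every contribution, including the first two, is an integral over `B₂` of one shape (`blowupTerm`):
up to the factor ℓ_{i+1}, a monomial in a, b, d times (S(m_{i+1} + L_i))^jc / ((1 +
ℓ_{i+1}e_{i+1})(1 + e_i)).

The monomial has degree 8 - jc, so only the part of degree jc - 2 of the quotient matters. That part
is m_{i+1}² times the second divided difference of t^jc at x = L_i, x' = L_{i+1}, y = L_i -
m_{i+1}e_i. Put z = L_i - m_i e_{i+1}. Then x - z, x' - z and x - x' are m_i, m_{i+2} and
ℓ_{i+1}m_{i+1} times e_{i+1}, so the recursion for divided differences turns the contribution into a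
difference of values on {x,y,z} and {x',y,z}. The recursion for the eᵢ makes the second value the
first one for the next step (`quotPart_telescope`, `C_mul_quotPart_eq_sub`).

The sum telescopes; its last term vanishes because m_{e+1} = 0, and its first involves only n and
m₁. Hence the algorithm may be replaced by the one-step algorithm with ℓ₁ = n/m₁, where `Q1` gives
the formula at once. -/

namespace DirectedBlowups

open Finset

/-! ### Divided differences of t^c and the telescoping identity. -/

section Algebra

variable {A B : Type*} [CommRing A] [CommRing B]

/-- The complete homogeneous polynomial of degree `c - 2` in `x`, `y`, `z` (zero if `c < 2`). -/
def hsym (c : ℕ) (x y z : A) : A :=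
  ∑ i ∈ range c, x ^ (c - 1 - i) * ∑ j ∈ range i, y ^ j * z ^ (i - 1 - j)

lemma map_hsym (f : A →+* B) (c : ℕ) (x y z : A) :
    f (hsym c x y z) = hsym c (f x) (f y) (f z) := by
  simp [hsym, map_sum]

lemma hsym_comm (c : ℕ) (x y z : A) : hsym c x y z = hsym c x z y := by
  unfold hsym
  refine sum_congr rfl fun i _ => ?_
  rw [← sum_range_reflect]
  congr 1
  refine sum_congr rfl fun j hj => ?_
  have : i - 1 - (i - 1 - j) = j := by have := mem_range.1 hj; omega
  rw [this, mul_comm]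

/-- `hsym` is the second divided difference of t^c; multiplying by the Vandermonde product clears
its denominators. -/
lemma sub_mul_hsym (c : ℕ) (x y z : A) :
    (y - z) * ((x - y) * (x - z) * hsym c x y z) =
      (y - z) * x ^ c - (x - z) * y ^ c + (x - y) * z ^ c := by
  have h1 : (y - z) * hsym c x y z =
      (∑ i ∈ range c, y ^ i * x ^ (c - 1 - i)) - ∑ i ∈ range c, z ^ i * x ^ (c - 1 - i) := by
    rw [hsym, mul_sum, ← sum_sub_distrib]
    refine sum_congr rfl fun i _ => ?_
    have := (Commute.all y z).geom_sum₂_mul i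
    linear_combination x ^ (c - 1 - i) * this
  have h2 := (Commute.all y x).geom_sum₂_mul c
  have h3 := (Commute.all z x).geom_sum₂_mul c
  linear_combination (x - y) * (x - z) * h1 - (x - z) * h2 + (x - y) * h3

/-- The part of degree `c - 2` of `(m + L) ^ c / ((1 + α) (1 + β))`, where `L`, `α`, `β` have
degree one. -/
def quotPart (c : ℕ) (m L α β : A) : A :=
  ∑ s ∈ range (c + 1), (m ^ s * L ^ (c - s) * c.choose s) *
    ∑ j ∈ range (s - 1), (-α) ^ j * (-β) ^ (s - 1 - 1 - j)

lemma map_quotPart (f : A →+* B) (c : ℕ) (m L α β : A) :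
    f (quotPart c m L α β) = quotPart c (f m) (f L) (f α) (f β) := by
  simp [quotPart, map_sum]

/-- Partial fractions in 1/((1+α)(1+β)), followed by the binomial theorem. Comparison with
`sub_mul_hsym` shows `quotPart` as m² times a divided difference at L, L - mα, L - mβ. -/
lemma mul_quotPart (c : ℕ) (m L α β : A) :
    α * β * (β - α) * quotPart c m L α β =
      (β - α) * L ^ c - β * (L - m * α) ^ c + α * (L - m * β) ^ c := by
  have e1 : (L - m * α) ^ c = (m * (-α) + L) ^ c := by ring
  have e2 : (L - m * β) ^ c = (m * (-β) + L) ^ c := by ring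
  have e3 : L ^ c = (m * 0 + L) ^ c := by ring
  -- L is written as m * 0 + L so that all three powers expand over the same index and can be
  -- compared term by term.
  rw [e1, e2, e3, add_pow, add_pow, add_pow, quotPart, mul_sum, mul_sum, mul_sum, mul_sum,
    ← sum_sub_distrib, ← sum_add_distrib]
  refine sum_congr rfl fun s _ => ?_
  rcases s with _ | s
  · simp; ring
  · have := (Commute.all (-α) (-β)).geom_sum₂_mul s
    simp only [Nat.add_sub_cancel, mul_pow, pow_succ, mul_zero, zero_mul]
    linear_combination α * β * m ^ s * m * L ^ (c - (s + 1)) * (c.choose (s + 1) : A) * this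

lemma quotPart_telescope_aux [IsDomain A] (c : ℕ) (l p q m m' L : A)
    (hp : p ≠ 0) (hq : q ≠ 0) (hr : q - l * p ≠ 0) (hz : (l * m + m') * p - m * q ≠ 0) :
    l * quotPart c m L (l * p) q =
      m * (l * m + m') * hsym c L (L - m * q) (L - (l * m + m') * p) -
      m' * m * hsym c (L - l * m * p) (L - m * q) (L - (l * m + m') * p) := by
  have h0 := mul_quotPart c m L (l * p) q
  have h1 := sub_mul_hsym c L (L - m * q) (L - (l * m + m') * p)
  have h2 := sub_mul_hsym c (L - l * m * p) (L - m * q) (L - (l * m + m') * p)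
  have e : L - m * (l * p) = L - l * m * p := by ring
  rw [e] at h0
  refine mul_left_cancel₀ (mul_ne_zero (mul_ne_zero (mul_ne_zero hp hq) hr) hz) ?_
  generalize hsym c L (L - m * q) (L - (l * m + m') * p) = H1 at *
  generalize hsym c (L - l * m * p) (L - m * q) (L - (l * m + m') * p) = H2 at *
  generalize quotPart c m L (l * p) q = E at *
  linear_combination ((l * m + m') * p - m * q) * h0 - (q - l * p) * h1 + q * h2

/-- A polynomial identity over ℤ: it is proved for indeterminates, where the denominators can be
cancelled, and then specialized. -/
lemma quotPart_telescope (c : ℕ) (l p q m m' L : A) :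
    l * quotPart c m L (l * p) q =
      m * (l * m + m') * hsym c L (L - m * q) (L - (l * m + m') * p) -
      m' * m * hsym c (L - l * m * p) (L - m * q) (L - (l * m + m') * p) := by
  have key := quotPart_telescope_aux (A := MvPolynomial (Fin 6) ℤ) c (.X 0) (.X 1) (.X 2) (.X 3)
    (.X 4) (.X 5) (MvPolynomial.X_ne_zero _) (MvPolynomial.X_ne_zero _)
    (fun h => by
      simpa using congrArg (MvPolynomial.eval (![0, 1, 1, 0, 0, 0] : Fin 6 → ℤ)) h)
    (fun h => by
      simpa using congrArg (MvPolynomial.eval (![0, 1, 0, 0, 1, 0] : Fin 6 → ℤ)) h)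
  have := congrArg (MvPolynomial.aeval (![l, p, q, m, m', L] : Fin 6 → A)).toRingHom key
  simpa only [map_mul, map_sub, map_add, map_hsym, map_quotPart, AlgHom.toRingHom_eq_coe,
    RingHom.coe_coe, MvPolynomial.aeval_X, Matrix.cons_val] using this

end Algebra

end DirectedBlowups

namespace DirectedBlowups
-- Push-forward along a projective bundle, in powers of x - ε.
section Push

variable {A : Type*} [CommRing A]

lemma ringInverse_eq {u v : A} (h : u * v = 1) : Ring.inverse u = v := by
  have : IsUnit u := .of_mul_eq_one v h
  rw [← mul_one (Ring.inverse u), ← h, ← mul_assoc, Ring.inverse_mul_cancel _ this, one_mul]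

/-- The class `x - ε` with cube zero in `ProjChow x`. -/
noncomputable def chernRoot (x : A) : ProjChow x := algebraMap A _ x - AdjoinRoot.root _

lemma chernRoot_cube (x : A) : chernRoot x ^ 3 = 0 := by
  have h : AdjoinRoot.mk ((X - C x) ^ 3 : A[X]) ((X - C x) ^ 3) = 0 := AdjoinRoot.mk_self
  simp only [map_pow, map_sub, AdjoinRoot.mk_X, AdjoinRoot.mk_C] at h
  rw [chernRoot, AdjoinRoot.algebraMap_eq]
  linear_combination -h

lemma push_chernRoot_pow (x : A) (j : ℕ) :
    push x (chernRoot x ^ j) = if j = 2 then 1 else 0 := by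
  nontriviality A
  obtain hj | hj := lt_or_ge 2 j
  · rw [if_neg hj.ne', pow_eq_zero_of_le hj (chernRoot_cube x), map_zero]
  have hmk : chernRoot x ^ j = AdjoinRoot.mk _ ((C x - X) ^ j) := by
    simp [chernRoot, AdjoinRoot.algebraMap_eq]
  have hd : ((C x - X : A[X]) ^ j).degree < ((X - C x : A[X]) ^ 3).degree := by
    rw [degree_eq_natDegree ((monic_X_sub_C x).pow 3).ne_zero, (monic_X_sub_C x).natDegree_pow,
      natDegree_X_sub_C]
    refine (degree_pow_le _ _).trans_lt ?_
    have : (C x - X : A[X]).degree = 1 := by rw [← neg_sub, degree_neg, degree_X_sub_C]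
    rw [this]
    norm_num
    exact_mod_cast (by omega : j < 3)
  rw [push, LinearMap.comp_apply, hmk, AdjoinRoot.modByMonicHom_mk,
    (modByMonic_eq_self_iff ((monic_X_sub_C x).pow 3)).2 hd, lcoeff_apply]
  interval_cases j
  · simp [coeff_one]
  · simp [coeff_X]
  · have : (C x - X : A[X]) ^ 2 = X ^ 2 - C (2 * x) * X + C (x ^ 2) := by
      simp only [C_mul, C_pow, map_ofNat]; ring
    rw [this, coeff_add, coeff_sub, coeff_C_mul, coeff_C, coeff_X, coeff_X_pow]
    simp

lemma push_chernRoot_pow_mul (x : A) (j : ℕ) (y : A) :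
    push x (chernRoot x ^ j * algebraMap A _ y) = if j = 2 then y else 0 := by
  rw [mul_comm, ← Algebra.smul_def, map_smul, push_chernRoot_pow]
  split_ifs <;> simp

/-- The push-forward of a geometric series in `chernRoot x`. -/
lemma push_chernRoot_inverse (x : A) {j : ℕ} (hj : j ≤ 2) {u : A} (hu : IsUnit u) (l y : A) :
    push x (chernRoot x ^ j * Ring.inverse (algebraMap A _ u - l • chernRoot x) *
      algebraMap A _ y) = l ^ (2 - j) * u ^ j * Ring.inverse u ^ 3 * y := by
  obtain ⟨v, hv⟩ := hu.exists_right_inv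
  have hv' : algebraMap A (ProjChow x) u * algebraMap A _ v = 1 := by
    rw [← map_mul, hv, map_one]
  have h3 := chernRoot_cube x
  rw [ringInverse_eq hv]
  -- The geometric series in `chernRoot x` stops after three terms, since its cube is zero.
  have hinv : Ring.inverse (algebraMap A _ u - l • chernRoot x) =
      algebraMap A _ v + algebraMap A _ (l * v ^ 2) * chernRoot x +
        algebraMap A _ (l ^ 2 * v ^ 3) * chernRoot x ^ 2 := by
    apply ringInverse_eq
    rw [Algebra.smul_def]
    simp only [map_mul, map_pow]
    generalize algebraMap A (ProjChow x) u = u' at *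
    generalize algebraMap A (ProjChow x) v = v' at *
    generalize algebraMap A (ProjChow x) l = l' at *
    generalize chernRoot x = z at *
    linear_combination (1 + l' * v' * z + l' ^ 2 * v' ^ 2 * z ^ 2) * hv' - l' ^ 3 * v' ^ 3 * h3
  have hs : chernRoot x ^ j * Ring.inverse (algebraMap A _ u - l • chernRoot x) *
      algebraMap A _ y = chernRoot x ^ j * algebraMap A _ (v * y) +
        chernRoot x ^ (j + 1) * algebraMap A _ (l * v ^ 2 * y) +
        chernRoot x ^ (j + 2) * algebraMap A _ (l ^ 2 * v ^ 3 * y) := by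
    rw [hinv]; simp only [map_mul, map_pow]; ring
  rw [hs, map_add, map_add, push_chernRoot_pow_mul, push_chernRoot_pow_mul,
    push_chernRoot_pow_mul]
  interval_cases j
  · simp
  · norm_num; linear_combination (- l * v ^ 2 * y) * hv
  · norm_num; linear_combination (- v * y - u * v ^ 2 * y) * hv

end Push

/-! ### Degrees on ℙ², `B₁` and `B₂` as coefficients. -/

section Int

variable {R : Type*} [CommRing R]

lemma chernRoot_zero : chernRoot (0 : R) = -hyp R := by simp [chernRoot, hyp]

lemma hyp_cube : hyp R ^ 3 = 0 := by
  have := chernRoot_cube (0 : R)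
  rw [chernRoot_zero] at this
  linear_combination -this

lemma intP2_hyp_pow (i : ℕ) : intP2 R (hyp R ^ i) = if i = 2 then 1 else 0 := by
  obtain hi | hi := lt_or_ge 2 i
  · rw [if_neg hi.ne', pow_eq_zero_of_le hi hyp_cube, map_zero]
  have h := push_chernRoot_pow (0 : R) i
  rw [chernRoot_zero, ← neg_one_smul R (hyp R), _root_.smul_pow, map_smul] at h
  change _ • intP2 R _ = _ at h
  interval_cases i <;> simpa using h

/-- The class `k - e₁` on `B₁`. -/
lemma chernRoot_hyp : chernRoot (hyp R) = k1 R - e1 R := rfl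

lemma intB1_pow (i j : ℕ) :
    intB1 R (k1 R ^ i * (k1 R - e1 R) ^ j) = if i = 2 ∧ j = 2 then 1 else 0 := by
  rw [intB1, LinearMap.comp_apply, LinearMap.restrictScalars_apply, ← chernRoot_hyp, k1,
    ← map_pow, mul_comm, push_chernRoot_pow_mul]
  by_cases h : j = 2
  · simp [h, intP2_hyp_pow]
  · simp [h]

lemma intB2_pow (l : ℕ → R) (i j r : ℕ) :
    intB2 (l 1) (k2 (l 1) ^ i * (k2 (l 1) - exc l 1) ^ j * chernRoot (rootB1 (l 1)) ^ r) =
      if i = 2 ∧ j = 2 ∧ r = 2 then 1 else 0 := by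
  have : k2 (l 1) ^ i * (k2 (l 1) - exc l 1) ^ j =
      algebraMap (ChowB1 R) _ (k1 R ^ i * (k1 R - e1 R) ^ j) := by
    simp [k2, exc]
  rw [intB2, LinearMap.comp_apply, LinearMap.restrictScalars_apply, this, mul_comm,
    push_chernRoot_pow_mul]
  by_cases h : r = 2
  · simp [h, intB1_pow]
  · simp [h]

/-- The evaluation of polynomials in three variables at the classes `k`, `k - e₁`,
`k - ℓ₁ e₁ - e₂`. -/
noncomputable def toB2 (l : ℕ → R) : MvPolynomial (Fin 3) R →ₐ[R] ChowB2 (l 1) :=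
  MvPolynomial.aeval ![k2 (l 1), k2 (l 1) - exc l 1, chernRoot (rootB1 (l 1))]

/-- The exponent vector `(2, 2, 2)`. -/
noncomputable def topExp : Fin 3 →₀ ℕ := Finsupp.equivFunOnFinite.symm fun _ => 2

/-- `ChowB2 (l 1)` varies with ℓ₁. Passing to coefficients in a fixed polynomial ring is what lets
different algorithms be compared. -/
lemma intB2_toB2 (l : ℕ → R) (p : MvPolynomial (Fin 3) R) :
    intB2 (l 1) (toB2 l p) = p.coeff topExp := by
  induction p using MvPolynomial.induction_on' with
  | add p q hp hq => rw [map_add, map_add, hp, hq, MvPolynomial.coeff_add]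
  | monomial d r =>
    rw [toB2, MvPolynomial.aeval_monomial, ← Algebra.smul_def, map_smul,
      Finsupp.prod_fintype _ _ (by simp), Fin.prod_univ_three, MvPolynomial.coeff_monomial]
    simp only [Matrix.cons_val]
    rw [intB2_pow]
    have : d = topExp ↔ d 0 = 2 ∧ d 1 = 2 ∧ d 2 = 2 := by
      rw [Finsupp.ext_iff, Fin.forall_fin_succ, Fin.forall_fin_succ, Fin.forall_fin_succ]
      simp [topExp]
    simp [this]

end Int
end DirectedBlowups

namespace DirectedBlowups
-- Reduction to degree 6 and telescoping of the common integral.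
section Polys

variable {R : Type*} [CommRing R]

open Finset in
lemma sum_range_range_eq {M : Type*} [AddCommMonoid M] {N N' s : ℕ} (hN : s ≤ N) (hN' : s ≤ N')
    (g : ℕ → ℕ → M) (hg : ∀ i j, i + j + 2 ≠ s → g i j = 0) :
    ∑ i ∈ range N, ∑ j ∈ range N', g i j = ∑ i ∈ range (s - 1), g i (s - 1 - 1 - i) := by
  have h1 : ∀ i ∈ range (s - 1), ∑ j ∈ range N', g i j = g i (s - 1 - 1 - i) := by
    intro i hi
    have := mem_range.1 hi
    refine sum_eq_single_of_mem _ (mem_range.2 (by omega)) fun j _ hj => hg _ _ (by omega)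
  rw [← sum_congr rfl h1]
  symm
  refine sum_subset (range_mono (by omega)) fun i _ hi => ?_
  have : ¬ i < s - 1 := fun h => hi (mem_range.2 h)
  exact sum_eq_zero fun j _ => hg _ _ (by omega)

lemma degree_topExp : topExp.degree = 6 := by
  rw [Finsupp.degree_eq_sum, Fin.sum_univ_three]; rfl

/-- Only the part of degree `6` of a product with two geometric series contributes to the
coefficient at `topExp`. -/
lemma coeff_topExp_geom {f c N N' : ℕ} (hfc : f + c = 8) (hN : c ≤ N) (hN' : c ≤ N') (m : R)
    {F L α β : MvPolynomial (Fin 3) R} (hF : F.IsHomogeneous f) (hL : L.IsHomogeneous 1)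
    (hα : α.IsHomogeneous 1) (hβ : β.IsHomogeneous 1) :
    (F * (.C m + L) ^ c * ((∑ i ∈ Finset.range N, (-α) ^ i) *
      ∑ j ∈ Finset.range N', (-β) ^ j)).coeff topExp =
    (F * quotPart c (.C m) L α β).coeff topExp := by
  rw [add_pow, quotPart, Finset.sum_mul_sum, Finset.mul_sum _ _ F, Finset.mul_sum _ _ F,
    Finset.sum_mul, MvPolynomial.coeff_sum, MvPolynomial.coeff_sum]
  refine Finset.sum_congr rfl fun s hs => ?_
  have hs := Finset.mem_range.1 hs
  simp_rw [Finset.mul_sum, MvPolynomial.coeff_sum]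
  rw [sum_range_range_eq (s := s) (by omega) (by omega)]
  · exact Finset.sum_congr rfl fun i _ => by rw [mul_assoc F]
  · intro i j hij
    -- As f + c = 8, this degree equals 6 only if i + j + 2 = s.
    have hh : (F * L ^ (c - s) * ((-α) ^ i * (-β) ^ j)).IsHomogeneous
        (f + 1 * (c - s) + (1 * i + 1 * j)) :=
      (hF.mul (hL.pow _)).mul ((hα.neg.pow _).mul (hβ.neg.pow _))
    have e : F * (.C m ^ s * L ^ (c - s) * (c.choose s : MvPolynomial (Fin 3) R)) *
        ((-α) ^ i * (-β) ^ j) =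
        .C (m ^ s * c.choose s) * (F * L ^ (c - s) * ((-α) ^ i * (-β) ^ j)) := by
      rw [MvPolynomial.C_mul, MvPolynomial.C_pow, map_natCast]; ring
    rw [e, MvPolynomial.coeff_C_mul, hh.coeff_eq_zero, mul_zero]
    rw [degree_topExp]
    omega

lemma inverse_one_add_eq_sum {A : Type*} [CommRing A] {x : A} (hx : IsNilpotent x) (c : ℕ) :
    ∃ N, c ≤ N ∧ Ring.inverse (1 + x) = ∑ i ∈ Finset.range N, (-x) ^ i := by
  obtain ⟨N, hN⟩ := hx
  refine ⟨N + c, by omega, ringInverse_eq ?_⟩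
  have := mul_neg_geom_sum (-x) (N + c)
  rw [sub_neg_eq_add] at this
  rw [this, neg_pow, pow_add x, hN]
  simp

/-- The linear forms `e₀, e₁, e₂, …` in `k`, `k - e₁`, `k - ℓ₁ e₁ - e₂`,
where `e₀ = ℓ₁ e₁ + e₂`. -/
noncomputable def excPoly (l : ℕ → R) : ℕ → MvPolynomial (Fin 3) R
  | 0 => .X 0 - .X 2
  | 1 => .X 0 - .X 1
  | (i + 2) => excPoly l i - .C (l (i + 1)) * excPoly l (i + 1)

lemma isHomogeneous_excPoly (l : ℕ → R) (i : ℕ) : (excPoly l i).IsHomogeneous 1 := by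
  induction i using Nat.twoStepInduction with
  | zero => exact (MvPolynomial.isHomogeneous_X _ _).sub (MvPolynomial.isHomogeneous_X _ _)
  | one => exact (MvPolynomial.isHomogeneous_X _ _).sub (MvPolynomial.isHomogeneous_X _ _)
  | more i h1 h2 => exact h1.sub (h2.C_mul _)

/-- The linear form `n k - ∑ ℓⱼ mⱼ eⱼ`, with `j` from `1` to `i`. -/
noncomputable def linPoly (n : R) (m l : ℕ → R) (i : ℕ) : MvPolynomial (Fin 3) R :=
  .C n * .X 0 - ∑ j ∈ Finset.Icc 1 i, .C (l j * m j) * excPoly l j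

lemma isHomogeneous_linPoly (n : R) (m l : ℕ → R) (i : ℕ) :
    (linPoly n m l i).IsHomogeneous 1 :=
  ((MvPolynomial.isHomogeneous_X _ _).C_mul _).sub
    (MvPolynomial.IsHomogeneous.sum _ _ _ fun j _ => (isHomogeneous_excPoly l j).C_mul _)

lemma linPoly_succ (n : R) (m l : ℕ → R) (i : ℕ) :
    linPoly n m l (i + 1) = linPoly n m l i - .C (l (i + 1) * m (i + 1)) * excPoly l (i + 1) := by
  rw [linPoly, linPoly, Finset.sum_Icc_succ_top (by omega)]; ring

/-- The monomial in `k`, `k - e₁`, `k - ℓ₁ e₁ - e₂` common to all contributions. -/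
noncomputable def frontPoly (R : Type*) [CommRing R] (jlam jmu jmub : ℕ) :
    MvPolynomial (Fin 3) R :=
  .X 0 ^ (jmub + 1) * .X 1 ^ jlam * .X 2 ^ jmu

lemma isHomogeneous_frontPoly (jlam jmu jmub : ℕ) :
    (frontPoly R jlam jmu jmub).IsHomogeneous (jmub + 1 + jlam + jmu) := by
  simpa [frontPoly] using (((MvPolynomial.isHomogeneous_X R (0 : Fin 3)).pow (jmub + 1)).mul
    ((MvPolynomial.isHomogeneous_X R (1 : Fin 3)).pow jlam)).mul
    ((MvPolynomial.isHomogeneous_X R (2 : Fin 3)).pow jmu)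

/-- The polynomials whose differences are the contributions of the blow-ups. -/
noncomputable def potential (c : ℕ) (n : R) (m l : ℕ → R) (i : ℕ) : MvPolynomial (Fin 3) R :=
  .C (m (i + 1) * m i) * hsym c (linPoly n m l i)
    (linPoly n m l i - .C (m (i + 1)) * excPoly l i)
    (linPoly n m l i - .C (m i) * excPoly l (i + 1))

/-- Passing from i to i + 1 replaces the first argument of `hsym` and interchanges the other two,
whence `hsym_comm`. -/
lemma C_mul_quotPart_eq_sub (c : ℕ) (n : R) (m l : ℕ → R) (i : ℕ)
    (h : m i = m (i + 1) * l (i + 1) + m (i + 2)) :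
    .C (l (i + 1)) * quotPart c (.C (m (i + 1))) (linPoly n m l i)
      (.C (l (i + 1)) * excPoly l (i + 1)) (excPoly l i) =
    potential c n m l i - potential c n m l (i + 1) := by
  have key := quotPart_telescope c (.C (l (i + 1))) (excPoly l (i + 1)) (excPoly l i)
    (.C (m (i + 1))) (.C (m (i + 2))) (linPoly n m l i)
  have hC : (.C (m i) : MvPolynomial (Fin 3) R) =
      .C (l (i + 1)) * .C (m (i + 1)) + .C (m (i + 2)) := by
    rw [h, MvPolynomial.C_add, MvPolynomial.C_mul, mul_comm]
  have e1 : linPoly n m l i - .C (l (i + 1)) * .C (m (i + 1)) * excPoly l (i + 1) -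
      .C (m (i + 2)) * excPoly l (i + 1) = linPoly n m l i - .C (m i) * excPoly l (i + 1) := by
    rw [hC]; ring
  have e2 : linPoly n m l i - .C (l (i + 1)) * .C (m (i + 1)) * excPoly l (i + 1) -
      .C (m (i + 1)) * (excPoly l i - .C (l (i + 1)) * excPoly l (i + 1)) =
      linPoly n m l i - .C (m (i + 1)) * excPoly l i := by ring
  rw [key, potential, potential, linPoly_succ, excPoly, MvPolynomial.C_mul, MvPolynomial.C_mul,
    MvPolynomial.C_mul, e1, e2, ← hC, hsym_comm c (_ - _ * excPoly l (i + 1))]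

lemma isNilpotent_chernRoot {A : Type*} [CommRing A] (x : A) : IsNilpotent (chernRoot x) :=
  ⟨3, chernRoot_cube x⟩

lemma isNilpotent_hyp : IsNilpotent (hyp R) := ⟨3, hyp_cube⟩

lemma isNilpotent_k1 : IsNilpotent (k1 R) := isNilpotent_hyp.map (algebraMap _ _)

lemma isNilpotent_e1 : IsNilpotent (e1 R) := by
  have h : e1 R = k1 R - chernRoot (hyp R) := by rw [chernRoot_hyp]; ring
  rw [h]
  exact (Commute.all _ _).isNilpotent_sub isNilpotent_k1 (isNilpotent_chernRoot _)

variable (l : ℕ → R)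

lemma toB2_X0 : toB2 l (.X 0) = k2 (l 1) := by simp [toB2]
lemma toB2_X1 : toB2 l (.X 1) = k2 (l 1) - exc l 1 := by simp [toB2]
lemma toB2_X2 : toB2 l (.X 2) = chernRoot (rootB1 (l 1)) := by simp [toB2]

lemma algebraMap_smul_chowB2 (r s : R) (x : ChowB1 R) :
    algebraMap (ChowB1 R) (ChowB2 s) (r • x) = r • algebraMap (ChowB1 R) (ChowB2 s) x :=
  map_smul (IsScalarTower.toAlgHom R (ChowB1 R) (ChowB2 s)) r x

lemma algebraMap_rootB1 :
    algebraMap (ChowB1 R) (ChowB2 (l 1)) (rootB1 (l 1)) = k2 (l 1) - l 1 • exc l 1 := by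
  change algebraMap (ChowB1 R) (ChowB2 (l 1)) (k1 R - l 1 • e1 R) = _
  rw [map_sub, algebraMap_smul_chowB2]
  rfl

lemma chernRoot_rootB1 :
    chernRoot (rootB1 (l 1)) = k2 (l 1) - l 1 • exc l 1 - exc l 2 := by
  rw [chernRoot, algebraMap_rootB1]
  rfl

lemma toB2_excPoly (i : ℕ) : toB2 l (excPoly l (i + 1)) = exc l (i + 1) := by
  induction i using Nat.twoStepInduction with
  | zero => rw [excPoly, map_sub, toB2_X0, toB2_X1]; ring
  | one =>
    simp only [excPoly, map_sub, map_mul, toB2_X0, toB2_X1, toB2_X2, chernRoot_rootB1,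
      ← MvPolynomial.algebraMap_eq, AlgHom.commutes, zero_add, Nat.reduceAdd, Algebra.smul_def]
    ring
  | more i h1 h2 =>
    rw [excPoly, map_sub, map_mul, h1, h2, ← MvPolynomial.algebraMap_eq, AlgHom.commutes,
      ← Algebra.smul_def, exc]

lemma isNilpotent_toB2_excPoly (i : ℕ) : IsNilpotent (toB2 l (excPoly l i)) := by
  have hk : IsNilpotent (k2 (l 1)) := isNilpotent_k1.map (algebraMap _ _)
  have hb := isNilpotent_chernRoot (rootB1 (l 1))
  induction i using Nat.twoStepInduction with
  | zero =>
    rw [excPoly, map_sub, toB2_X0, toB2_X2]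
    exact (Commute.all _ _).isNilpotent_sub hk hb
  | one =>
    rw [toB2_excPoly, exc]
    exact isNilpotent_e1.map (algebraMap _ _)
  | more i h1 h2 =>
    rw [excPoly, map_sub, map_mul]
    exact (Commute.all _ _).isNilpotent_sub h1 ((Commute.all _ _).isNilpotent_mul_left h2)

/-- The common form of all contributions, as a degree on `B₂`. -/
noncomputable def blowupTerm (jlam jmu jmub jc : ℕ) (S n : R) (m l : ℕ → R) (i : ℕ) : R :=
  l (i + 1) * intB2 (l 1)
    (toB2 l (frontPoly R jlam jmu jmub) *
      (S • toB2 l (.C (m (i + 1)) + linPoly n m l i)) ^ jc *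
      Ring.inverse (1 + toB2 l (.C (l (i + 1)) * excPoly l (i + 1))) *
      Ring.inverse (1 + toB2 l (excPoly l i)))

lemma blowupTerm_eq {jlam jmu jmub jc : ℕ} (hsum : jmu + jmub + jlam + jc = 7) (S n : R)
    (m l : ℕ → R) (i : ℕ) (h : m i = m (i + 1) * l (i + 1) + m (i + 2)) :
    blowupTerm jlam jmu jmub jc S n m l i =
      S ^ jc * (frontPoly R jlam jmu jmub * potential jc n m l i).coeff topExp -
      S ^ jc * (frontPoly R jlam jmu jmub * potential jc n m l (i + 1)).coeff topExp := by
  have hp : IsNilpotent (toB2 l (.C (l (i + 1)) * excPoly l (i + 1))) := by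
    rw [map_mul]
    exact (Commute.all _ _).isNilpotent_mul_left (isNilpotent_toB2_excPoly l _)
  obtain ⟨N, hN, e1⟩ := inverse_one_add_eq_sum hp jc
  obtain ⟨N', hN', e2⟩ := inverse_one_add_eq_sum (isNilpotent_toB2_excPoly l i) jc
  rw [← mul_sub, ← MvPolynomial.coeff_sub, ← mul_sub, ← C_mul_quotPart_eq_sub jc n m l i h,
    blowupTerm, e1, e2, _root_.smul_pow]
  have e3 : toB2 l (frontPoly R jlam jmu jmub) *
      S ^ jc • toB2 l (.C (m (i + 1)) + linPoly n m l i) ^ jc *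
      (∑ j ∈ Finset.range N, (-toB2 l (.C (l (i + 1)) * excPoly l (i + 1))) ^ j) *
      (∑ j ∈ Finset.range N', (-toB2 l (excPoly l i)) ^ j) =
      S ^ jc • toB2 l (frontPoly R jlam jmu jmub * (.C (m (i + 1)) + linPoly n m l i) ^ jc *
        ((∑ j ∈ Finset.range N, (-(.C (l (i + 1)) * excPoly l (i + 1))) ^ j) *
        ∑ j ∈ Finset.range N', (-excPoly l i) ^ j)) := by
    simp only [map_mul, map_sum, map_pow, map_neg, Algebra.smul_def]
    ring
  rw [e3, map_smul, intB2_toB2, coeff_topExp_geom (f := jmub + 1 + jlam + jmu) (by omega) hN hN'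
    _ (isHomogeneous_frontPoly _ _ _) (isHomogeneous_linPoly n m l i)
    ((isHomogeneous_excPoly l _).C_mul _) (isHomogeneous_excPoly l i), mul_left_comm (frontPoly _ _ _ _),
    MvPolynomial.coeff_C_mul, smul_eq_mul]
  ring

end Polys
end DirectedBlowups

namespace DirectedBlowups
-- Each `Q` is a `blowupTerm`.
section Contributions

variable {R : Type*} [CommRing R]

lemma ringInverse_mul {A : Type*} [CommRing A] {u v : A} (hu : IsUnit u) (hv : IsUnit v) :
    Ring.inverse (u * v) = Ring.inverse u * Ring.inverse v := by
  apply ringInverse_eq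
  linear_combination v * Ring.inverse v * Ring.mul_inverse_cancel u hu +
    Ring.mul_inverse_cancel v hv

lemma ringInverse_pow {A : Type*} [CommRing A] {u : A} (hu : IsUnit u) (k : ℕ) :
    Ring.inverse (u ^ k) = Ring.inverse u ^ k := by
  apply ringInverse_eq
  rw [← mul_pow, Ring.mul_inverse_cancel u hu, one_pow]

lemma ringInverse_map {A B : Type*} [CommRing A] [CommRing B] (f : A →+* B) {u : A}
    (hu : IsUnit u) : Ring.inverse (f u) = f (Ring.inverse u) := by
  apply ringInverse_eq
  rw [← map_mul, Ring.mul_inverse_cancel u hu, map_one]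

/-- The variant of `push_chernRoot_inverse` with a scalar from a smaller ring. -/
lemma push_chernRoot_inverse' {A : Type*} [CommRing A] [Algebra R A] (x : A) {j : ℕ}
    (hj : j ≤ 2) {u : A} (hu : IsUnit u) (l : R) (y : A) :
    push x (chernRoot x ^ j * Ring.inverse (algebraMap A _ u - l • chernRoot x) *
      algebraMap A _ y) = l ^ (2 - j) • (u ^ j * Ring.inverse u ^ 3 * y) := by
  rw [← algebraMap_smul A l (chernRoot x), push_chernRoot_inverse x hj hu, Algebra.smul_def,
    map_pow]
  ring

lemma algebraMap_smul_projChow {A : Type*} [CommRing A] [Algebra R A] (x : A) (r : R) (y : A) :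
    algebraMap A (ProjChow x) (r • y) = r • algebraMap A (ProjChow x) y := by
  rw [Algebra.smul_def, map_mul, ← IsScalarTower.algebraMap_apply, ← Algebra.smul_def]

lemma one_add_smul_root {A : Type*} [CommRing A] [Algebra R A] (x : A) (l : R) :
    1 + l • (AdjoinRoot.root _ : ProjChow x) =
      algebraMap A (ProjChow x) (1 + l • x) - l • chernRoot x := by
  rw [map_add, map_one, algebraMap_smul_projChow, add_sub_assoc, ← smul_sub, chernRoot,
    sub_sub_cancel]

lemma one_add_algebraMap {A B : Type*} [CommRing A] [CommRing B] [Algebra A B] (y : A) :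
    1 + algebraMap A B y = algebraMap A B (1 + y) := by
  rw [map_add, map_one]

lemma one_add_smul_algebraMap {A : Type*} [CommRing A] [Algebra R A] (x y : A) (r : R) :
    1 + r • algebraMap A (ProjChow x) y = algebraMap A _ (1 + r • y) := by
  rw [map_add, map_one, algebraMap_smul_projChow]

lemma smul_algebraMap_add_sub {A : Type*} [CommRing A] [Algebra R A] (x k e : A) (r s t u : R) :
    r • (algebraMap R (ProjChow x) s + (t • algebraMap A _ k - u • algebraMap A _ e)) =
      algebraMap A (ProjChow x) (r • (algebraMap R A s + (t • k - u • e))) := by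
  rw [algebraMap_smul_projChow, map_add, map_sub, algebraMap_smul_projChow,
    algebraMap_smul_projChow, ← IsScalarTower.algebraMap_apply]

lemma smul_algebraMap_add {A : Type*} [CommRing A] [Algebra R A] (x k : A) (r s t : R) :
    r • (algebraMap R (ProjChow x) s + t • algebraMap A _ k) =
      algebraMap A (ProjChow x) (r • (algebraMap R A s + t • k)) := by
  rw [algebraMap_smul_projChow, map_add, algebraMap_smul_projChow,
    ← IsScalarTower.algebraMap_apply]

/-- The push-forward of a contribution to the base of the projective bundle. -/
lemma push_contribution {A : Type*} [CommRing A] [Algebra R A] (x : A) {j : ℕ} (hj : j ≤ 2)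
    {u v : A} (hu : IsUnit u) (hv : IsUnit v) (l : R) (k a M : A) (s t c : ℕ) :
    push x (algebraMap A _ k ^ s * algebraMap A _ a ^ t * chernRoot x ^ j *
      algebraMap A _ M ^ c * Ring.inverse (algebraMap A _ u - l • chernRoot x) *
      Ring.inverse (algebraMap A _ v)) =
    l ^ (2 - j) • (u ^ j * Ring.inverse u ^ 3 * (k ^ s * a ^ t * M ^ c * Ring.inverse v)) := by
  rw [← push_chernRoot_inverse' x hj hu, ringInverse_map _ hv]
  congr 1
  simp only [map_mul, map_pow]
  ring

lemma toB2_C (l : ℕ → R) (r : R) : toB2 l (.C r) = algebraMap R _ r := by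
  rw [← MvPolynomial.algebraMap_eq, AlgHom.commutes]

lemma toB2_C_mul (l : ℕ → R) (r : R) (x : MvPolynomial (Fin 3) R) :
    toB2 l (.C r * x) = r • toB2 l x := by
  rw [← MvPolynomial.smul_eq_C_mul, map_smul]

set_option maxHeartbeats 1000000 in
lemma toB2_linPoly (n : R) (m l : ℕ → R) (i : ℕ) :
    toB2 l (linPoly n m l i) =
      n • k2 (l 1) - ∑ j ∈ Finset.Icc 1 i, (l j * m j) • exc l j := by
  rw [linPoly, map_sub (toB2 l), map_sum (toB2 l), toB2_C_mul, toB2_X0]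
  congr 1
  refine Finset.sum_congr rfl fun j hj => ?_
  obtain ⟨j, rfl⟩ : ∃ i, j = i + 1 := ⟨j - 1, by have := (Finset.mem_Icc.1 hj).1; omega⟩
  rw [toB2_C_mul, toB2_excPoly]

set_option maxHeartbeats 1000000 in
lemma toB2_C_add_linPoly (r n : R) (m l : ℕ → R) (i : ℕ) :
    toB2 l (.C r + linPoly n m l i) = algebraMap R _ r +
      (n • k2 (l 1) - ∑ j ∈ Finset.Icc 1 i, (l j * m j) • exc l j) := by
  rw [map_add (toB2 l), toB2_C, toB2_linPoly]

lemma toB2_frontPoly (l : ℕ → R) (jlam jmu jmub : ℕ) :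
    toB2 l (frontPoly R jlam jmu jmub) =
      k2 (l 1) ^ (jmub + 1) * (k2 (l 1) - exc l 1) ^ jlam * chernRoot (rootB1 (l 1)) ^ jmu := by
  simp only [frontPoly, map_mul, map_pow, toB2_X0, toB2_X1, toB2_X2]

lemma k2_sub_exc (l : ℕ → R) :
    k2 (l 1) - exc l 1 = algebraMap (ChowB1 R) (ChowB2 (l 1)) (k1 R - e1 R) :=
  (map_sub _ _ _).symm

variable (jlam jmu jmub jc : ℕ) (S n : R) (m l : ℕ → R)

lemma contribution_ge3_aux {A : Type*} [CommRing A] [Algebra R A]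
    {k a b M N L x y F p q W : A} {r s : R} (hx : IsNilpotent x) (hy : IsNilpotent y)
    (hF : F = k ^ (jmub + 1) * a ^ jlam * b ^ jmu) (hp : p = s • (x - r • y))
    (hq : q = y) (hW : W = N + (M - L)) :
    k * b ^ jmu * a ^ jlam * k ^ jmub * (S • (N + M - L)) ^ jc *
      Ring.inverse ((1 + s • x - (r * s) • y) * (1 + y)) =
    F * (S • W) ^ jc * Ring.inverse (1 + p) * Ring.inverse (1 + q) := by
  have hz : IsNilpotent p := hp ▸ ((Commute.all _ _).isNilpotent_sub hx (hy.smul r)).smul s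
  have h : 1 + s • x - (r * s) • y = 1 + p := by
    rw [hp, smul_sub, smul_smul, mul_comm r]; ring
  rw [h, ringInverse_mul hz.isUnit_one_add hy.isUnit_one_add, hW, hF, hq, ← add_sub_assoc]
  ring

lemma Qge3_eq_blowupTerm (i : ℕ) :
    Qge3 jlam jmu jmub jc S n m l (i + 3) = blowupTerm jlam jmu jmub jc S n m l (i + 2) := by
  have n1 : ∀ j, IsNilpotent (exc l (j + 1)) := fun j =>
    toB2_excPoly l j ▸ isNilpotent_toB2_excPoly l (j + 1)
  have hF := toB2_frontPoly l jlam jmu jmub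
  have hp := (toB2_C_mul l (l (i + 3)) (excPoly l (i + 3))).trans
    (congrArg (l (i + 3) • ·) (toB2_excPoly l (i + 2)))
  have hW := toB2_C_add_linPoly (m (i + 3)) n m l (i + 2)
  rw [chernRoot_rootB1] at hF
  have key := contribution_ge3_aux jlam jmu jmub jc S (n1 i) (n1 (i + 1)) hF hp
    (toB2_excPoly l (i + 1)) hW
  exact congrArg (fun y => l (i + 3) * intB2 (l 1) y) key

lemma contribution_two_aux {A : Type*} [CommRing A] [Algebra R A] (k a M e : A) (r s : R)
    (hk : IsNilpotent k) (he : IsNilpotent e) :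
    k * (1 + s • k - (r * s) • e) ^ jmu * a ^ jlam * k ^ jmub * M ^ jc *
      Ring.inverse ((1 + s • k - (r * s) • e) ^ 3 * (1 + e)) =
    (1 + s • (k - r • e)) ^ jmu * Ring.inverse (1 + s • (k - r • e)) ^ 3 *
      (k ^ (jmub + 1) * a ^ jlam * M ^ jc * Ring.inverse (1 + e)) := by
  have hz : IsNilpotent (s • (k - r • e)) :=
    ((Commute.all _ _).isNilpotent_sub hk (he.smul r)).smul s
  have h : 1 + s • k - (r * s) • e = 1 + s • (k - r • e) := by
    rw [smul_sub, smul_smul, mul_comm r]; ring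
  rw [h, ringInverse_mul (hz.isUnit_one_add.pow 3) he.isUnit_one_add,
    ringInverse_pow hz.isUnit_one_add]
  ring

lemma smul_add_sub_aux {A : Type*} [CommRing A] [Algebra R A] (k e : A) (r s t : R) :
    algebraMap R A (S * t) + (S * n) • k - (S * r * s) • e =
      S • (algebraMap R A t + (n • k - (r * s) • e)) := by
  simp only [Algebra.smul_def, map_mul]; ring

set_option maxHeartbeats 1000000 in
-- Since 1 + ℓ₂e₂ = (1 + ℓ₂(k - ℓ₁e₁)) - ℓ₂d with d = k - ℓ₁e₁ - e₂, pushing forward to `B₁`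
-- produces the powers of ℓ₂ and of the Chern class in `Q2`.
lemma Q2_eq_blowupTerm (hmu : jmu ≤ 2) :
    Q2 jlam jmu jmub jc S n m l = blowupTerm jlam jmu jmub jc S n m l 1 := by
  have hr : IsNilpotent (rootB1 (l 1)) :=
    (Commute.all _ _).isNilpotent_sub isNilpotent_k1 (isNilpotent_e1.smul _)
  have hu : IsUnit (1 + l 2 • rootB1 (l 1)) := (hr.smul _).isUnit_one_add
  have he : IsUnit (1 + e1 R) := isNilpotent_e1.isUnit_one_add
  have h2 : 1 + toB2 l (.C (l 2) * excPoly l 2) =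
      algebraMap (ChowB1 R) _ (1 + l 2 • rootB1 (l 1)) - l 2 • chernRoot (rootB1 (l 1)) := by
    rw [toB2_C_mul, toB2_excPoly]
    exact one_add_smul_root _ _
  have h3 : 1 + toB2 l (excPoly l 1) = algebraMap (ChowB1 R) _ (1 + e1 R) := by
    rw [toB2_excPoly]; exact one_add_algebraMap _
  have h4 : S • toB2 l (.C (m 2) + linPoly n m l 1) = algebraMap (ChowB1 R) (ChowB2 (l 1))
      (S • (algebraMap R _ (m 2) + (n • k1 R - (l 1 * m 1) • e1 R))) := by
    rw [toB2_C_add_linPoly, Finset.Icc_self, Finset.sum_singleton]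
    exact smul_algebraMap_add_sub _ _ _ _ _ _ _
  rw [Q2, blowupTerm, h2, h3, h4, toB2_frontPoly, k2_sub_exc, k2, intB2, LinearMap.comp_apply,
    LinearMap.restrictScalars_apply, push_contribution _ hmu hu he, map_smul, smul_eq_mul,
    ← mul_assoc, ← pow_succ', show 2 - jmu + 1 = 3 - jmu by omega, smul_add_sub_aux,
    contribution_two_aux jlam jmu jmub jc _ _ _ _ _ _ isNilpotent_k1 isNilpotent_e1]
  rfl

lemma contribution_one_aux {A : Type*} [CommRing A] [Algebra R A] (k M : A) (r : R)
    (hk : IsNilpotent k) :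
    k * (1 + k) ^ jmu * (1 + r • k) ^ jlam * k ^ jmub * M ^ jc *
      Ring.inverse ((1 + r • k) ^ 3 * (1 + k) ^ 3) =
    (1 + r • k) ^ jlam * Ring.inverse (1 + r • k) ^ 3 *
      ((1 + k) ^ jmu * Ring.inverse (1 + k) ^ 3 * k ^ (jmub + 1) * M ^ jc) := by
  have h1 := hk.isUnit_one_add
  have h2 := (hk.smul r).isUnit_one_add
  rw [ringInverse_mul (h2.pow 3) (h1.pow 3), ringInverse_pow h1, ringInverse_pow h2]
  ring

lemma smul_add_aux {A : Type*} [CommRing A] [Algebra R A] (k : A) (t : R) :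
    algebraMap R A (S * t) + (S * n) • k = S • (algebraMap R A t + n • k) := by
  simp only [Algebra.smul_def, map_mul]; ring

/-- The push-forward of the first contribution from `B₁` to `ℙ²`. -/
lemma push_contribution_one {A : Type*} [CommRing A] [Algebra R A] (x : A) {j : ℕ} (hj : j ≤ 2)
    (hx : IsNilpotent x) (l : R) (M : A) (s t c : ℕ) :
    push x ((1 + algebraMap A _ x) ^ t * Ring.inverse (1 + algebraMap A _ x) ^ 3 *
      (algebraMap A _ x ^ s * (algebraMap A _ x - AdjoinRoot.root _) ^ j * algebraMap A _ M ^ c *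
        Ring.inverse (1 + l • AdjoinRoot.root _))) =
    l ^ (2 - j) • ((1 + l • x) ^ j * Ring.inverse (1 + l • x) ^ 3 *
      ((1 + x) ^ t * Ring.inverse (1 + x) ^ 3 * x ^ s * M ^ c)) := by
  have h1 : 1 + algebraMap A (ProjChow x) x = algebraMap A _ (1 + x) := by
    rw [map_add, map_one]
  rw [← push_chernRoot_inverse' x hj (hx.smul l).isUnit_one_add, one_add_smul_root, h1,
    ringInverse_map _ hx.isUnit_one_add, ← chernRoot]
  congr 1
  simp only [map_mul, map_pow]
  ring

set_option maxHeartbeats 1000000 in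
-- Two push-forwards: 1 + e₀ = (1 + k) - d yields the power of 1 + k on `B₁`, then 1 + ℓ₁e₁ = (1 +
-- ℓ₁k) - ℓ₁(k - e₁) yields the power of 1 + ℓ₁k on ℙ².
lemma Q1_eq_blowupTerm (hlam : jlam ≤ 2) (hmu : jmu ≤ 2) :
    Q1 jlam jmu jmub jc S n m l = blowupTerm jlam jmu jmub jc S n m l 0 := by
  have hk1 : IsUnit (1 + k1 R) := isNilpotent_k1.isUnit_one_add
  have he : IsUnit (1 + l 1 • e1 R) := (isNilpotent_e1.smul _).isUnit_one_add
  have h1 : 1 + toB2 l (.C (l 1) * excPoly l 1) =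
      algebraMap (ChowB1 R) _ (1 + l 1 • e1 R) := by
    rw [toB2_C_mul, toB2_excPoly]; exact one_add_smul_algebraMap _ _ _
  have h2 : 1 + toB2 l (excPoly l 0) =
      algebraMap (ChowB1 R) _ (1 + k1 R) - (1 : R) • chernRoot (rootB1 (l 1)) := by
    rw [excPoly, map_sub (toB2 l), toB2_X0, toB2_X2, one_smul, ← one_add_algebraMap, k2,
      add_sub_assoc]
  have h3 : S • toB2 l (.C (m 1) + linPoly n m l 0) = algebraMap (ChowB1 R) (ChowB2 (l 1))
      (algebraMap (ChowP2 R) (ChowB1 R) (S • (algebraMap R _ (m 1) + n • hyp R))) := by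
    rw [toB2_C_add_linPoly, Finset.Icc_eq_empty (by simp), Finset.sum_empty, sub_zero, k2, k1,
      smul_algebraMap_add, smul_algebraMap_add]
  have h4 := push_contribution_one (hyp R) hlam isNilpotent_hyp (l 1)
    (S • (algebraMap R _ (m 1) + n • hyp R)) (jmub + 1) jmu jc
  rw [Q1, blowupTerm, mul_right_comm (toB2 l _ * _), smul_add_aux,
    contribution_one_aux jlam jmu jmub jc _ _ _ isNilpotent_hyp, h1, h2, h3, toB2_frontPoly,
    k2_sub_exc, k2, intB2, LinearMap.comp_apply,
    LinearMap.restrictScalars_apply, push_contribution _ hmu hk1 he, one_pow, one_smul, intB1,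
    LinearMap.comp_apply, LinearMap.restrictScalars_apply]
  refine Eq.trans ?_ (congrArg (fun y => l 1 * intP2 R y) h4.symm)
  simp only [map_smul, smul_eq_mul, ← mul_assoc, ← pow_succ']
  rw [show 2 - jlam + 1 = 3 - jlam by omega]

lemma Q_succ_eq_blowupTerm (hlam : jlam ≤ 2) (hmu : jmu ≤ 2) (i : ℕ) :
    Q jlam jmu jmub jc S n m l (i + 1) = blowupTerm jlam jmu jmub jc S n m l i := by
  rcases i with _ | _ | i
  · exact Q1_eq_blowupTerm _ _ _ _ _ _ _ _ hlam hmu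
  · exact Q2_eq_blowupTerm _ _ _ _ _ _ _ _ hmu
  · exact Qge3_eq_blowupTerm _ _ _ _ _ _ _ _ i

variable {jlam jmu jmub jc}

lemma P_eq_sub (hlam : jlam ≤ 2) (hmu : jmu ≤ 2) (hsum : jmu + jmub + jlam + jc = 7) (e : ℕ)
    (h : ∀ i < e, m i = m (i + 1) * l (i + 1) + m (i + 2)) :
    P jlam jmu jmub jc S n m l e =
      S ^ jc * (frontPoly R jlam jmu jmub * potential jc n m l 0).coeff topExp -
      S ^ jc * (frontPoly R jlam jmu jmub * potential jc n m l e).coeff topExp := by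
  induction e with
  | zero => simp [P]
  | succ e ih =>
    have hP := ih fun i hi => h i (hi.trans e.lt_succ_self)
    rw [P] at hP ⊢
    rw [Finset.sum_Icc_succ_top (by omega), hP, Q_succ_eq_blowupTerm _ _ _ _ _ _ _ _ hlam hmu,
      blowupTerm_eq hsum _ _ _ _ _ (h e e.lt_succ_self)]
    ring

end Contributions

/-! ### Comparison with the one-step algorithm. -/

section Field

variable {K : Type*} [Field K] {jlam jmu jmub jc : ℕ}

/-- The total correction term only depends on the first line of the algorithm. -/
lemma IsEuclidean.P_eq {n m₁ : K} {e : ℕ} {m l : ℕ → K} (h : IsEuclidean n m₁ e m l)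
    (hlam : jlam ≤ 2) (hmu : jmu ≤ 2) (hsum : jmu + jmub + jlam + jc = 7) (S : K) :
    P jlam jmu jmub jc S n m l e =
      S ^ jc * (frontPoly K jlam jmu jmub * (.C (m₁ * n) * hsym jc (.C n * .X 0)
        (.C n * .X 0 - .C m₁ * (.X 0 - .X 2))
        (.C n * .X 0 - .C n * (.X 0 - .X 1)))).coeff topExp := by
  have h0 : potential jc n m l e = 0 := by simp [potential, h.last]
  rw [P_eq_sub S n m l hlam hmu hsum e h.step, h0, potential, h.zero, h.one, linPoly]
  simp [excPoly]

lemma isEuclidean_one {n m₁ : K} (hm : m₁ ≠ 0) :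
    IsEuclidean n m₁ 1 (fun i => if i = 0 then n else if i = 1 then m₁ else 0)
      fun _ => n / m₁ where
  one_le := le_rfl
  zero := rfl
  one := rfl
  last := rfl
  ne_zero i h1 h2 := by obtain rfl := le_antisymm h2 h1; exact hm
  step i hi := by obtain rfl := Nat.lt_one_iff.1 hi; simp [mul_div_cancel₀ _ hm]

/-- With n = mℓ, the factor Sm + Snk is Sm(1 + ℓk), which cancels against the denominator. -/
lemma Q1_integrand_eq {A : Type*} [CommRing A] [Algebra K A] {k : A} (hk : IsNilpotent k)
    {p r q : ℕ} (hp : jlam + p = 3) (hq : jmu + q = 3) (hr : jc = p + r) (S m l : K) :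
    k * (1 + k) ^ jmu * (1 + l • k) ^ jlam * k ^ jmub *
      (algebraMap K A (S * m) + (S * (m * l)) • k) ^ jc *
      Ring.inverse ((1 + l • k) ^ 3 * (1 + k) ^ 3) =
    (S ^ jc * m ^ p) • (k ^ (jmub + 1) * (algebraMap K A m + (m * l) • k) ^ r *
      Ring.inverse ((1 + k) ^ q)) := by
  have h1 := hk.isUnit_one_add
  have h2 := (hk.smul l).isUnit_one_add
  have h1' : (1 + k) ^ jmu * Ring.inverse (1 + k) ^ jmu = 1 := by
    rw [← mul_pow, Ring.mul_inverse_cancel _ h1, one_pow]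
  have h2' : (1 + l • k) ^ (jlam + p) * Ring.inverse (1 + l • k) ^ (jlam + p) = 1 := by
    rw [← mul_pow, Ring.mul_inverse_cancel _ h2, one_pow]
  have e1 : algebraMap K A (S * m) + (S * (m * l)) • k =
      algebraMap K A S * algebraMap K A m * (1 + l • k) := by
    simp only [Algebra.smul_def, map_mul]; ring
  have e2 : algebraMap K A m + (m * l) • k = algebraMap K A m * (1 + l • k) := by
    simp only [Algebra.smul_def, map_mul]; ring
  rw [e1, e2, ringInverse_mul (h2.pow 3) (h1.pow 3), ringInverse_pow h1, ringInverse_pow h2,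
    ringInverse_pow h1, Algebra.smul_def (S ^ jc * m ^ p), map_mul, map_pow, map_pow]
  have e3 : Ring.inverse (1 + k) ^ 3 = Ring.inverse (1 + k) ^ (jmu + q) := by rw [hq]
  have e4 : Ring.inverse (1 + l • k) ^ 3 = Ring.inverse (1 + l • k) ^ (jlam + p) := by rw [hp]
  rw [e3, e4, hr]
  generalize Ring.inverse (1 + k) = v at *
  generalize Ring.inverse (1 + l • k) = w at *
  generalize 1 + l • k = u at *
  generalize algebraMap K A S = S
  generalize algebraMap K A m = m
  calc _ = k ^ (jmub + 1) * S ^ (p + r) * m ^ (p + r) * u ^ r * v ^ q *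
        ((1 + k) ^ jmu * v ^ jmu) * (u ^ (jlam + p) * w ^ (jlam + p)) := by ring
    _ = _ := by rw [h1', h2']; ring

lemma Q1_eq (hlam : jlam ≤ 2) (hmu : jmu ≤ 2) (hjc : 3 ≤ jc + jlam) (S : K) (m l : ℕ → K) :
    Q1 jlam jmu jmub jc S (m 1 * l 1) m l =
      S ^ jc * (m 1 * l 1) ^ (3 - jlam) * intP2 K
      (hyp K ^ (jmub + 1) * (algebraMap K _ (m 1) + (m 1 * l 1) • hyp K) ^ (jc + jlam - 3) *
        Ring.inverse ((1 + hyp K) ^ (3 - jmu))) := by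
  rw [Q1, Q1_integrand_eq isNilpotent_hyp (p := 3 - jlam) (q := 3 - jmu) (r := jc + jlam - 3)
    (by omega) (by omega) (by omega), map_smul, smul_eq_mul]
  ring

lemma IsEuclidean.P_eq_intP2 {n m₁ : K} {e : ℕ} {m l : ℕ → K} (h : IsEuclidean n m₁ e m l)
    (hlam : jlam ≤ 2) (hmu : jmu ≤ 2) (hmub : jmub ≤ 2) (hsum : jmu + jmub + jlam + jc = 7)
    (S : K) :
    P jlam jmu jmub jc S n m l e = S ^ jc * n ^ (3 - jlam) * intP2 K
      (hyp K ^ (jmub + 1) * (algebraMap K _ m₁ + n • hyp K) ^ (jc + jlam - 3) *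
        Ring.inverse ((1 + hyp K) ^ (3 - jmu))) := by
  have hm : m₁ ≠ 0 := h.one ▸ h.ne_zero 1 le_rfl h.one_le
  -- The given algorithm is exchanged for the one-step one, whose sum is `Q1` alone.
  rw [h.P_eq hlam hmu hsum S, ← (isEuclidean_one hm).P_eq hlam hmu hsum S, P, Finset.Icc_self,
    Finset.sum_singleton]
  have hn : m₁ * (n / m₁) = n := mul_div_cancel₀ n hm
  have hQ := Q1_eq (jmub := jmub) hlam hmu (by omega : 3 ≤ jc + jlam) S
    (fun i => if i = 0 then n else if i = 1 then m₁ else 0) fun _ => n / m₁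
  simp only [one_ne_zero, if_false, if_true, hn] at hQ
  exact hQ

end Field
end DirectedBlowups

/-- The exponent `jc + jlam - 3` does not truncate: the hypotheses give `3 ≤ jc + jlam`. -/
theorem lemma3p4 {K : Type*} [Field K] (jlam jmu jmub jc : ℕ)
    (hlam : jlam ≤ 2) (hmu : jmu ≤ 2) (hmub : jmub ≤ 2) (hsum : jmu + jmub + jlam + jc = 7)
    (S n m₁ : K) :
    (∀ (e : ℕ) (m l : ℕ → K), DirectedBlowups.IsEuclidean n m₁ e m l →
      DirectedBlowups.P jlam jmu jmub jc S n m l e =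
        S ^ jc * n ^ (3 - jlam) * DirectedBlowups.intP2 K
          (DirectedBlowups.hyp K ^ (jmub + 1) *
            (algebraMap K _ m₁ + n • DirectedBlowups.hyp K) ^ (jc + jlam - 3) *
            Ring.inverse ((1 + DirectedBlowups.hyp K) ^ (3 - jmu)))) ∧
    (∀ (e e' : ℕ) (m l m' l' : ℕ → K),
      DirectedBlowups.IsEuclidean n m₁ e m l → DirectedBlowups.IsEuclidean n m₁ e' m' l' →
      DirectedBlowups.P jlam jmu jmub jc S n m l e =
        DirectedBlowups.P jlam jmu jmub jc S n m' l' e') := by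
  refine ⟨fun e m l h => h.P_eq_intP2 hlam hmu hmub hsum S, fun e e' m l m' l' h h' => ?_⟩
  rw [h.P_eq hlam hmu hsum S, h'.P_eq hlam hmu hsum S]
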